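/- Let $X$ be a set, $d$ a positive integer, $S_d$ the symmetric group, and $K$ a field of characteristic $0$ or of characteristic $p>d$. Write $K(S_d)$ for the group algebra, with basis $\{e_\sigma\}_{\sigma\in S_d}$, and $ZK(S_d)$ for its center. The group $S_d$ acts on functions $F:X^d\to K$ by $(\sigma F)(x_1,\dots,x_d)=F(x_{\sigma(1)},\dots,x_{\sigma(d)})$, and this action extends linearly to $K(S_d)$. Let $C^d(X,K)$ be a linear subspace of the space of functions $X^d\to K$ that is invariant under $S_d$. Let $\mathrm{Irr}(S_d)$ be the set of isomorphism classes of irreducible representations of $S_d$ over $K$. For $V\in\mathrm{Irr}(S_d)$ let $\beta_V$ be the corresponding primitive idempotent: a nonzero central idempotent of $K(S_d)$ that is not the sum of two nonzero orthogonal central idempotents, and such that the algebra homomorphism $K(S_d)\to \mathrm{End}(V)$ maps $\beta_VK(S_d)$ bijectively onto its image. For a conjugacy class $\lambda$ of $S_d$ (that is, a partition of $d$) put $\alpha_\lambda=\sum_{\sigma\in\lambda}e_\sigma$; let $P'$ be the set of conjugacy classes other than that of the identity (the partition $(1,\dots,1)$), let $I$ be the kernel of the homomorphism of $K$-algebras $K[\{x_\lambda\}_{\lambda\in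 P'}]\to ZK(S_d)$, $x_\lambda\mapsto\alpha_\lambda$, and let $V(I)\subset K^{P'}$ be the set of common zeros of $I$. Let $a_V=(a_{V,\lambda})_{\lambda\in P'}$ be the point of $V(I)$ at which $\beta_V$, viewed as a class of polynomials modulo $I$, does not vanish. Then each $\beta_V$ and each $a_V$ exists and is unique, and $$C^d(X,K)=\bigoplus_{V\in\mathrm{Irr}(S_d)}W^d_V(X,K),\qquad W^d_V(X,K):=\beta_VC^d(X,K).$$ Moreover, for every $V\in\mathrm{Irr}(S_d)$ and every $F\in C^d(X,K)$, each of the following two conditions is equivalent to $F\in W^d_V(X,K)$: (i) for each $\lambda\in P'$ and all $x_1,\dots,x_d\in X$, $$\sum_{\sigma\in\lambda}F(x_{\sigma(1)},\dots,x_{\sigma(d)})=a_{V,\lambda}F(x_1,\dots,x_d);$$ (ii) $\beta_VF=F$. -/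

import Mathlib

open scoped MonoidAlgebra

universe u v

noncomputable section

namespace SymmetryClasses

section Group

variable (K : Type u) [Field K] (G : Type v) [Group G]

/-- The irreducible representations of `G` over `K`. Every irreducible representation of `G` is
isomorphic to a quotient of the group algebra, so no irreducible representation is missed by
fixing this universe. -/
abbrev IrrRep : Type (max u v + 1) :=
  {V : Rep.{max u v} K G // V.ρ.IsIrreducible}

/-- Isomorphism of irreducible representations. -/
instance irrRepSetoid : Setoid (IrrRep K G) where
  r V W := Nonempty (Representation.Equiv V.1.ρ W.1.ρ)
  iseqv :=
    { refl := fun V => ⟨Representation.Equiv.refl V.1.ρ⟩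
      symm := fun ⟨e⟩ => ⟨e.symm⟩
      trans := fun ⟨e⟩ ⟨f⟩ => ⟨e.trans f⟩ }

/-- `Irr_K(G)`: the set of isomorphism classes of irreducible representations of `G` over `K`. -/
def Irr : Type (max u v + 1) := Quotient (irrRepSetoid K G)

instance : DecidableEq (Irr K G) := Classical.decEq _

variable {K G}

/-- A central idempotent `β ≠ 0` of a ring is primitive if it is not the sum of two nonzero
orthogonal central idempotents. -/
structure IsPrimitiveCentralIdempotent {A : Type*} [Ring A] (β : A) : Prop where
  mem_center : β ∈ Subring.center A
  isIdempotentElem : IsIdempotentElem β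
  ne_zero : β ≠ 0
  eq_zero_or_eq_zero : ∀ e f : A, e ∈ Subring.center A → f ∈ Subring.center A →
    IsIdempotentElem e → IsIdempotentElem f → e * f = 0 → β = e + f → e = 0 ∨ f = 0

/-- `β` is the primitive idempotent of `K(G)` corresponding to the irreducible representation
`ρ : G → Aut(V)`: it is a primitive idempotent, and the algebra map `K(G) → End(V)` extending `ρ`
maps `β K(G)` bijectively onto its image. -/
def CorrespondsTo (V : IrrRep K G) (β : K[G]) : Prop :=
  IsPrimitiveCentralIdempotent β ∧
    Set.BijOn V.1.ρ.asAlgebraHom (Set.range fun α : K[G] => β * α)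
      (Set.range V.1.ρ.asAlgebraHom)

/-- The same relation for an isomorphism class (it does not depend on the representative). -/
def IsIdempotentOf (V : Irr K G) (β : K[G]) : Prop :=
  ∀ U : IrrRep K G, Quotient.mk (irrRepSetoid K G) U = V → CorrespondsTo U β

/-- The primitive idempotent `β_V` of `K(G)` corresponding to `V ∈ Irr_K(G)`. -/
def idempotentOf (V : Irr K G) : K[G] :=
  Classical.epsilon (IsIdempotentOf V)

variable [Fintype G]

/-- The elements of a conjugacy class. -/
def classElems (c : ConjClasses G) : Finset G :=
  Set.Finite.toFinset (Set.toFinite c.carrier)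

theorem mem_classElems {c : ConjClasses G} {g : G} :
    g ∈ classElems c ↔ ConjClasses.mk g = c := by
  simp [classElems, ConjClasses.mem_carrier_iff_mk_eq]

variable (K) in
/-- `α_c = ∑_{g ∈ c} e_g`, for a conjugacy class `c`. -/
def classSum (c : ConjClasses G) : K[G] :=
  ∑ g ∈ classElems c, MonoidAlgebra.single g (1 : K)

theorem classSum_mem_center (c : ConjClasses G) :
    classSum K c ∈ Subalgebra.center K K[G] := by
  rw [Subalgebra.mem_center_iff]
  intro b
  induction b using MonoidAlgebra.induction_linear with
  | zero => simp
  | add x y hx hy => rw [add_mul, mul_add, hx, hy]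
  | single h r =>
    simp only [classSum, Finset.mul_sum, Finset.sum_mul, MonoidAlgebra.single_mul_single,
      mul_one, one_mul]
    refine Finset.sum_bij' (fun g _ => h * g * h⁻¹) (fun g _ => h⁻¹ * g * h) ?_ ?_ ?_ ?_ ?_
    · intro g hg
      rw [mem_classElems] at hg ⊢
      rw [← hg, ConjClasses.mk_eq_mk_iff_isConj]
      exact (isConj_iff.2 ⟨h, rfl⟩ : IsConj g _).symm
    · intro g hg
      rw [mem_classElems] at hg ⊢
      rw [← hg, ConjClasses.mk_eq_mk_iff_isConj]
      exact (isConj_iff.2 ⟨h⁻¹, by simp⟩ : IsConj g _).symm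
    · intro g _; group
    · intro g _; group
    · intro g _; simp

variable (G) in
/-- The set `P'` of conjugacy classes different from the class of `1`. -/
abbrev NonidClass : Type v := {c : ConjClasses G // c ≠ ConjClasses.mk (1 : G)}

variable (K G) in
/-- The natural map of `K`-algebras `K[{x_c}_{c ∈ P'}] → ZK(G)`, `x_c ↦ α_c`. -/
def centerPresentation : MvPolynomial (NonidClass G) K →ₐ[K] Subalgebra.center K K[G] :=
  MvPolynomial.aeval fun c => ⟨classSum K c.1, classSum_mem_center c.1⟩

variable (K G) in
/-- The finite set of points `V(I)` associated with `G`, where `I` is the ideal of relations among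
the `α_c`, `c ∈ P'`. -/
def points : Set (NonidClass G → K) :=
  MvPolynomial.zeroLocus K (RingHom.ker (centerPresentation K G))

/-- `a` is the point of `V(I)` corresponding to `V`: the one at which `β_V`, seen in
`K[{x_c}]/I ≅ ZK(G)`, does not vanish. -/
def IsPointOf (V : Irr K G) (a : NonidClass G → K) : Prop :=
  a ∈ points K G ∧ ∃ f : MvPolynomial (NonidClass G) K,
    (centerPresentation K G f : K[G]) = idempotentOf V ∧ MvPolynomial.eval a f ≠ 0

/-- The point `a_V` corresponding to `V ∈ Irr_K(G)`. -/
def pointOf (V : Irr K G) : NonidClass G → K :=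
  Classical.epsilon (IsPointOf V)

end Group

section Functions

variable (d : ℕ) (X : Type v) (K : Type u) [Field K]

/-- The action of `S_d` on functions of `d` variables:
`(σ F)(x_1, …, x_d) = F(x_{σ(1)}, …, x_{σ(d)})`. -/
def permuteVars : Representation K (Equiv.Perm (Fin d)) ((Fin d → X) → K) where
  toFun σ :=
    { toFun := fun F x => F (fun i => x (σ i))
      map_add' := fun _ _ => rfl
      map_smul' := fun _ _ => rfl }
  map_one' := rfl
  map_mul' _ _ := rfl

variable {d X K}

/-- `W_V = β_V C`, for an `S_d`-invariant space `C` of functions of `d` variables. -/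
def symmetryClass (C : Subrepresentation (permuteVars d X K))
    (V : Irr K (Equiv.Perm (Fin d))) : Submodule K C.toSubmodule :=
  LinearMap.range (C.toRepresentation.asAlgebraHom (idempotentOf V))

end Functions

end SymmetryClasses

end

/-! By Maschke, `K[S_d]` is semisimple, so its center is a finite product of fields. The component
idempotents are primitive, mutually orthogonal and sum to `1`. Each irreducible representation is
acted on as the identity by exactly one of them (Schur), and each of them acts as the identity on
exactly one isomorphism class. Hence every module splits as the sum of the ranges of the `β_V`.

For the points `a_V` the factors of the center must be `K` itself, so that class sums act on each
block by scalars in `K` (`exists_mul_eq_smul_of_isPrimitive`). A permutation is conjugate to its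
powers prime to its order. Taking traces of idempotents in the regular representation then shows
that central idempotents over the algebraic closure have coefficients in the prime field
(`coeff_mem_of_central_idempotent`). So they descend to `K`.

Then `a_V` lists the eigenvalues of the class sums on the block of `β_V`. Class sums generate the
center, so `β_V` is a polynomial `f` in them with `f(a_V) ≠ 0`. A vector with these eigenvalues
satisfies `β_V F = f(a_V) F`, so it lies in the range of `β_V`. -/

namespace SymmetryClasses

/-! ### Central idempotents and nilpotents in semisimple rings -/

section RingTheory

/-- In a semisimple ring, a two-sided ideal, presented as the kernel of a ring homomorphism, is
generated by a central idempotent. -/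
theorem exists_central_idempotent_of_ker {A B : Type*} [Ring A] [IsSemisimpleRing A] [Ring B]
    (φ : A →+* B) :
    ∃ e : A, e ∈ Subring.center A ∧ IsIdempotentElem e ∧ φ e = 0 ∧ ∀ x, φ x = 0 → e * x = x := by
  obtain ⟨e, he, hI⟩ := IsSemisimpleRing.ideal_eq_span_idempotent (RingHom.ker φ)
  -- The opposite ring turns the kernel into a right ideal, giving a left identity `f` beside the
  -- right identity `e`; the two must coincide.
  obtain ⟨f', hf, hJ⟩ := IsSemisimpleRing.ideal_eq_span_idempotent (RingHom.ker φ.op)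
  obtain ⟨f, rfl⟩ := MulOpposite.op_surjective f'
  have hφe : φ e = 0 := by
    rw [← RingHom.mem_ker, hI]; exact Ideal.mem_span_singleton_self e
  have hφf : φ f = 0 := by
    have : MulOpposite.op f ∈ RingHom.ker φ.op := by
      rw [hJ]; exact Ideal.mem_span_singleton_self _
    exact MulOpposite.op_injective this
  have hff : f * f = f := MulOpposite.op_injective hf
  have right_id : ∀ x, φ x = 0 → x * e = x := fun x hx => by
    have hx' : x ∈ Ideal.span {e} := hI ▸ (RingHom.mem_ker.2 hx)
    obtain ⟨a, rfl⟩ := Ideal.mem_span_singleton'.1 hx'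
    rw [mul_assoc, he]
  have left_id : ∀ x, φ x = 0 → f * x = x := fun x hx => by
    have hx' : MulOpposite.op x ∈ Ideal.span {MulOpposite.op f} := by
      rw [← hJ, RingHom.mem_ker]
      exact congrArg MulOpposite.op hx
    obtain ⟨a, ha⟩ := Ideal.mem_span_singleton'.1 hx'
    have ha' : f * a.unop = x := MulOpposite.op_injective ha
    rw [← ha', ← mul_assoc, hff]
  have hef : f = e := (right_id f hφf).symm.trans (left_id e hφe)
  subst hef
  refine ⟨f, Subring.mem_center_iff.2 fun a => ?_, he, hφe, left_id⟩
  rw [← left_id (a * f) (by simp [hφe]), ← mul_assoc, right_id (f * a) (by simp [hφe])]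

/-- The ideal of `z` is generated by an idempotent `e = a * z`; as `a` and `z` commute, a high power
of `e`, which is `e` itself, vanishes. -/
theorem eq_zero_of_mem_center_of_isNilpotent {A : Type*} [Ring A] [IsSemisimpleRing A] {z : A}
    (hz : z ∈ Subring.center A) (hn : IsNilpotent z) : z = 0 := by
  obtain ⟨e, he, hI⟩ := IsSemisimpleRing.ideal_eq_span_idempotent (Ideal.span {z})
  obtain ⟨a, ha⟩ := Ideal.mem_span_singleton'.1
    (hI ▸ Ideal.mem_span_singleton_self e : e ∈ Ideal.span {z})
  obtain ⟨b, hb⟩ := Ideal.mem_span_singleton'.1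
    (hI ▸ Ideal.mem_span_singleton_self z : z ∈ Ideal.span {e})
  obtain ⟨n, hn⟩ := hn
  have hcomm : Commute a z := Subring.mem_center_iff.1 hz a
  have h0 : e ^ (n + 1) = 0 := by
    rw [← ha, hcomm.mul_pow, pow_succ z, hn, zero_mul, mul_zero]
  rw [he.pow_succ_eq] at h0
  rw [← hb, h0, mul_zero]

instance center_isReduced {k A : Type*} [Field k] [Ring A] [Algebra k A] [IsSemisimpleRing A] :
    IsReduced (Subalgebra.center k A) where
  eq_zero z hz := Subtype.ext <| eq_zero_of_mem_center_of_isNilpotent z.2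
    (hz.map (Subalgebra.center k A).val)

/-! ### Component idempotents of reduced Artinian rings -/

section Artinian

variable {Z : Type*} [CommRing Z] [IsArtinianRing Z] [IsReduced Z]

open scoped Classical in
variable (Z) in
/-- The idempotent of a reduced Artinian ring that is `1` at the maximal ideal `m` and `0` at the
other maximal ideals. -/
noncomputable def componentIdempotent (m : MaximalSpectrum Z) : Z :=
  (IsArtinianRing.equivPi Z).symm (Pi.single m 1)

theorem equivPi_mul_componentIdempotent [DecidableEq (MaximalSpectrum Z)] (z : Z)
    (m : MaximalSpectrum Z) :
    IsArtinianRing.equivPi Z (z * componentIdempotent Z m) =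
      Pi.single m (Ideal.Quotient.mk m.asIdeal z) := by
  rw [map_mul, componentIdempotent, AlgEquiv.apply_symm_apply]
  ext m'
  by_cases h : m' = m
  · subst h; simp
  · simp [h]

theorem isIdempotentElem_componentIdempotent (m : MaximalSpectrum Z) :
    IsIdempotentElem (componentIdempotent Z m) := by
  classical
  apply (IsArtinianRing.equivPi Z).injective
  rw [equivPi_mul_componentIdempotent, ← one_mul (componentIdempotent Z m),
    equivPi_mul_componentIdempotent, one_mul]
  congr 1
  have := congrFun (equivPi_mul_componentIdempotent (1 : Z) m) m
  simpa using this

theorem sum_componentIdempotent [Fintype (MaximalSpectrum Z)] :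
    ∑ m, componentIdempotent Z m = 1 := by
  classical
  apply (IsArtinianRing.equivPi Z).injective
  rw [map_sum, map_one]
  have : ∀ m, IsArtinianRing.equivPi Z (componentIdempotent Z m) = Pi.single m 1 := fun m => by
    rw [← one_mul (componentIdempotent Z m), equivPi_mul_componentIdempotent, map_one]
  simp_rw [this]
  exact Finset.univ_sum_single (1 : ∀ m : MaximalSpectrum Z, Z ⧸ m.asIdeal)

theorem componentIdempotent_ne_zero (m : MaximalSpectrum Z) : componentIdempotent Z m ≠ 0 := by
  classical
  intro h
  have := congrFun (equivPi_mul_componentIdempotent (1 : Z) m) m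
  rw [h] at this
  simp at this

/-- A component idempotent is primitive. -/
theorem mul_componentIdempotent_eq_zero_or_self {f : Z} (hf : IsIdempotentElem f)
    (m : MaximalSpectrum Z) :
    f * componentIdempotent Z m = 0 ∨ f * componentIdempotent Z m = componentIdempotent Z m := by
  classical
  have h : IsIdempotentElem (Ideal.Quotient.mk m.asIdeal f) := hf.map _
  rcases IsIdempotentElem.iff_eq_zero_or_one.1 h with h | h
  · left
    apply (IsArtinianRing.equivPi Z).injective
    rw [equivPi_mul_componentIdempotent, h, map_zero, Pi.single_zero]
  · right
    apply (IsArtinianRing.equivPi Z).injective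
    rw [equivPi_mul_componentIdempotent, h, ← one_mul (componentIdempotent Z m),
      equivPi_mul_componentIdempotent, map_one]

/-- Over an algebraically closed field the components of a finite-dimensional reduced commutative
algebra are one-dimensional. -/
theorem exists_mul_componentIdempotent_eq_smul {k : Type*} [Field k] [IsAlgClosed k] [Algebra k Z]
    [Module.Finite k Z] (z : Z) (m : MaximalSpectrum Z) :
    ∃ r : k, z * componentIdempotent Z m = r • componentIdempotent Z m := by
  classical
  have : IsDomain (Z ⧸ m.asIdeal) := inferInstance
  have : Algebra.IsIntegral k (Z ⧸ m.asIdeal) := Algebra.IsIntegral.of_finite _ _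
  obtain ⟨r, hr⟩ := (IsAlgClosed.algebraMap_bijective_of_isIntegral
    (k := k) (K := Z ⧸ m.asIdeal)).2 (Ideal.Quotient.mk m.asIdeal z)
  refine ⟨r, (IsArtinianRing.equivPi Z).injective ?_⟩
  rw [Algebra.smul_def, equivPi_mul_componentIdempotent, equivPi_mul_componentIdempotent, ← hr]
  rfl

end Artinian

end RingTheory

/-! ### Rationality of central idempotents -/

section Rationality

variable {k G : Type*} [Field k] [Group G]

theorem coeff_conj_of_mem_center {z : k[G]} (hz : z ∈ Subring.center k[G]) {g h : G}
    (hgh : IsConj g h) : z.coeff g = z.coeff h := by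
  obtain ⟨x, rfl⟩ := isConj_iff.1 hgh
  have h := congrArg (fun y : k[G] => y.coeff (x * g))
    (Subring.mem_center_iff.1 hz (MonoidAlgebra.single x 1))
  simpa [MonoidAlgebra.coeff_single_mul_apply, MonoidAlgebra.coeff_mul_single_apply] using h

variable [Finite G]

instance finite_monoidAlgebra : Module.Finite k k[G] :=
  Module.Finite.of_basis (MonoidAlgebra.basis G k)

theorem trace_monoidAlgebra (x : k[G]) :
    LinearMap.trace k k[G] (Algebra.lmul k k[G] x) = (Nat.card G : k) * x.coeff 1 := by
  classical
  cases nonempty_fintype G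
  rw [LinearMap.trace_eq_matrix_trace k (MonoidAlgebra.basis G k),
    Matrix.trace]
  simp [LinearMap.toMatrix_apply, MonoidAlgebra.basis, MonoidAlgebra.coeff_mul_single_apply]

/-- The trace of a projection is its rank, an integer. -/
theorem trace_mem_of_isIdempotentElem (F : Subfield k) {e : k[G]} (he : IsIdempotentElem e) :
    LinearMap.trace k k[G] (Algebra.lmul k k[G] e) ∈ F := by
  have h : IsIdempotentElem (Algebra.lmul k k[G] e) := he.map _
  rw [(LinearMap.IsIdempotentElem.isProj_range _ h).trace]
  exact natCast_mem F _

theorem natCast_orderOf_ne_zero {k G : Type*} [Field k] [Group G] [NeZero (Nat.card G : k)]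
    (g : G) : (orderOf g : k) ≠ 0 := by
  intro h
  obtain ⟨c, hc⟩ := orderOf_dvd_natCard g
  apply NeZero.ne (Nat.card G : k)
  rw [hc, Nat.cast_mul, h, zero_mul]

variable [NeZero (Nat.card G : k)]

/-- With `N` the sum over the cyclic group of `g` and `n` its order, `e * N / n` is idempotent. Its
trace on `k[G]` is `|G| / n` times the sum in question. -/
theorem sum_coeff_pow_mem (F : Subfield k) {e : k[G]} (hc : e ∈ Subring.center k[G])
    (he : IsIdempotentElem e) (g : G) :
    ∑ j ∈ Finset.range (orderOf g), e.coeff (g ^ j) ∈ F := by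
  -- Inverses make the coefficient of `e * N` at `1` equal to the sum of `e.coeff (g ^ j)`.
  set N : k[G] := ∑ j ∈ Finset.range (orderOf g), MonoidAlgebra.single (g⁻¹ ^ j) 1 with hN
  set n : k := (orderOf g : k) with hn
  have hn0 : n ≠ 0 := natCast_orderOf_ne_zero g
  have hshift : MonoidAlgebra.single g⁻¹ (1 : k) * N = N := by
    rw [hN, Finset.mul_sum]
    simp_rw [MonoidAlgebra.single_mul_single, ← pow_succ', one_mul]
    have h := Finset.sum_range_succ (fun j => MonoidAlgebra.single (g⁻¹ ^ j) (1 : k)) (orderOf g)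
    rw [Finset.sum_range_succ'] at h
    simpa [pow_orderOf_eq_one] using h
  have hshift' (j : ℕ) : MonoidAlgebra.single (g⁻¹ ^ j) (1 : k) * N = N := by
    induction j with
    | zero => rw [pow_zero, ← MonoidAlgebra.one_def, one_mul]
    | succ j ih =>
      rw [pow_succ, ← one_mul (1 : k), ← MonoidAlgebra.single_mul_single, mul_assoc, hshift, ih]
  have hNN : N * N = n • N := by
    conv_lhs => enter [1]; rw [hN]
    rw [Finset.sum_mul, Finset.sum_congr rfl fun j _ => hshift' j]
    simp [hn, Nat.cast_smul_eq_nsmul]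
  have hidem : IsIdempotentElem (n⁻¹ • (e * N)) := by
    have hcomm : N * e = e * N := Subring.mem_center_iff.1 hc N
    have : e * N * (e * N) = n • (e * N) := by
      rw [mul_assoc, ← mul_assoc N, hcomm, mul_assoc, hNN, ← mul_assoc, he.eq, mul_smul_comm]
    rw [IsIdempotentElem, smul_mul_smul_comm, this, smul_smul, mul_assoc, inv_mul_cancel₀ hn0,
      mul_one]
  have htr := trace_mem_of_isIdempotentElem F hidem
  rw [map_smul, map_smul, trace_monoidAlgebra, smul_eq_mul] at htr
  have hcoeff : (e * N).coeff 1 = ∑ j ∈ Finset.range (orderOf g), e.coeff (g ^ j) := by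
    rw [hN, Finset.mul_sum, MonoidAlgebra.coeff_sum, Finset.sum_apply']
    simp [MonoidAlgebra.coeff_mul_single_apply]
  rw [hcoeff] at htr
  have h1 := F.mul_mem (natCast_mem F (orderOf g)) htr
  rw [← mul_assoc, ← hn, mul_inv_cancel₀ hn0, one_mul] at h1
  have h2 := F.mul_mem (F.inv_mem (natCast_mem F (Nat.card G))) h1
  rwa [← mul_assoc, inv_mul_cancel₀ (NeZero.ne _), one_mul] at h2

/-- If every element of `G` is conjugate to its powers by exponents prime to its order, then the
coefficients of central idempotents of `k[G]` lie in the prime field. -/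
theorem coeff_mem_of_central_idempotent
    (hconj : ∀ (g : G) (n : ℕ), (orderOf g).Coprime n → IsConj g (g ^ n))
    (htot : ∀ g : G, ((orderOf g).totient : k) ≠ 0)
    (F : Subfield k) {e : k[G]} (hc : e ∈ Subring.center k[G])
    (he : IsIdempotentElem e) (g : G) : e.coeff g ∈ F := by
  induction hn : orderOf g using Nat.strong_induction_on generalizing g with
  | _ n ih =>
    have hsum := sum_coeff_pow_mem F hc he g
    -- Exponents prime to the order give conjugates of `g`, hence equal coefficients; the others
    -- give elements of smaller order, covered by induction.
    rw [← Finset.sum_filter_add_sum_filter_not _ (fun j => (orderOf g).Coprime j)] at hsum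
    have h1 : ∑ j ∈ Finset.range (orderOf g) with (orderOf g).Coprime j, e.coeff (g ^ j) =
        ((orderOf g).totient : k) * e.coeff g := by
      rw [Finset.sum_congr rfl fun j hj =>
        (coeff_conj_of_mem_center hc (hconj g j (Finset.mem_filter.1 hj).2)).symm,
        Finset.sum_const, nsmul_eq_mul, Nat.totient_eq_card_coprime]
    have h2 : ∑ j ∈ Finset.range (orderOf g) with ¬ (orderOf g).Coprime j, e.coeff (g ^ j) ∈ F := by
      refine sum_mem fun j hj => ih _ ?_ (g ^ j) rfl
      rw [← hn, orderOf_pow]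
      refine Nat.div_lt_self (orderOf_pos g) ?_
      have h0 := Nat.gcd_pos_of_pos_left j (orderOf_pos g)
      have h1 : (orderOf g).gcd j ≠ 1 := (Finset.mem_filter.1 hj).2
      omega
    have h3 : ((orderOf g).totient : k) * e.coeff g ∈ F := by
      rw [← h1]; simpa using F.sub_mem hsum h2
    have h4 := F.mul_mem (F.inv_mem (natCast_mem F (orderOf g).totient)) h3
    rwa [← mul_assoc, inv_mul_cancel₀ (htot g), one_mul] at h4

end Rationality

/-! ### Arithmetic of symmetric groups -/

section SymmetricGroup

/-- A power of a cycle prime to its order is a cycle with the same support; disjoint factors are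
treated separately. -/
theorem cycleType_pow_of_coprime {α : Type*} [Fintype α] [DecidableEq α] (σ : Equiv.Perm α)
    {n : ℕ} : (orderOf σ).Coprime n → (σ ^ n).cycleType = σ.cycleType := by
  induction σ using Equiv.Perm.cycle_induction_on with
  | base_one => simp
  | base_cycles σ hσ =>
    intro h
    rw [(hσ.pow_iff.2 h.symm).cycleType, hσ.cycleType, Equiv.Perm.support_pow_coprime h.symm]
  | induction_disjoint σ τ hd _ hσ hτ =>
    intro h
    rw [hd.orderOf] at h
    rw [hd.commute.mul_pow, (hd.pow_disjoint_pow n n).cycleType_mul, hd.cycleType_mul,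
      hσ (h.coprime_dvd_left (Nat.dvd_lcm_left _ _)),
      hτ (h.coprime_dvd_left (Nat.dvd_lcm_right _ _))]

theorem isConj_pow_of_coprime {α : Type*} [Fintype α] [DecidableEq α] (σ : Equiv.Perm α) (n : ℕ)
    (h : (orderOf σ).Coprime n) : IsConj σ (σ ^ n) :=
  Equiv.Perm.isConj_iff_cycleType_eq.2 (cycleType_pow_of_coprime σ h).symm

variable {K : Type*} [Field K] {d : ℕ}

theorem natCast_ne_zero_of_prime_factors_le (hK : ringChar K = 0 ∨ d < ringChar K) {n : ℕ}
    (hn : n ≠ 0) (h : ∀ p : ℕ, p.Prime → p ∣ n → p ≤ d) : (n : K) ≠ 0 := by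
  intro h0
  have hdvd := (ringChar.spec K n).1 h0
  rcases CharP.char_is_prime_or_zero K (ringChar K) with hp | hp
  · have := h _ hp hdvd
    rcases hK with hK | hK
    · exact hp.ne_zero hK
    · omega
  · rw [hp] at hdvd
    exact hn (Nat.eq_zero_of_zero_dvd hdvd)

theorem natCast_card_perm_ne_zero (hK : ringChar K = 0 ∨ d < ringChar K) :
    (Nat.card (Equiv.Perm (Fin d)) : K) ≠ 0 := by
  refine natCast_ne_zero_of_prime_factors_le hK Nat.card_pos.ne' fun p hp hpd => ?_
  rw [Nat.card_perm, Nat.card_fin] at hpd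
  exact hp.dvd_factorial.1 hpd

theorem natCast_totient_orderOf_ne_zero (hK : ringChar K = 0 ∨ d < ringChar K)
    (σ : Equiv.Perm (Fin d)) : ((orderOf σ).totient : K) ≠ 0 := by
  have hle : ∀ p : ℕ, p.Prime → p ∣ orderOf σ → p ≤ d := fun p hp hpd => by
    have := hpd.trans (orderOf_dvd_natCard σ)
    rw [Nat.card_perm, Nat.card_fin] at this
    exact hp.dvd_factorial.1 this
  refine natCast_ne_zero_of_prime_factors_le hK
    (Nat.totient_pos.2 (orderOf_pos σ)).ne' fun p hp hpd => ?_
  -- By `φ(n) ∏ q = n ∏ (q - 1)`, a prime factor of `φ(n)` divides `n` or some `q - 1` with `q ∣ n`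
  -- prime, hence `q ≤ d`.
  have h := Nat.totient_mul_prod_primeFactors (orderOf σ)
  rcases hp.dvd_mul.1 (h ▸ hpd.mul_right _) with h | h
  · exact hle p hp h
  · obtain ⟨q, hq, hpq⟩ := (hp.prime.dvd_finsetProd_iff _).1 h
    have hq' := Nat.mem_primeFactors.1 hq
    have := Nat.le_of_dvd (Nat.sub_pos_of_lt hq'.1.one_lt) hpq
    have := hle q hq'.1 hq'.2.1
    omega

end SymmetricGroup

/-! ### Primitive central idempotents -/

section Primitive

variable {A : Type*} [Ring A] {β : A}

/-- Primitivity applies to the orthogonal splitting `β = f * β + (1 - f) * β`. -/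
theorem IsPrimitiveCentralIdempotent.mul_eq_self_of_mul_ne_zero
    (hβ : IsPrimitiveCentralIdempotent β) {f : A} (hf : f ∈ Subring.center A)
    (hfi : IsIdempotentElem f) (h : f * β ≠ 0) : f * β = β := by
  have hcomm : Commute f β := (Subring.mem_center_iff.1 hf β).symm
  have hf' : 1 - f ∈ Subring.center A := sub_mem (one_mem _) hf
  have hcomm' : Commute (1 - f) β := (Subring.mem_center_iff.1 hf' β).symm
  have := hβ.eq_zero_or_eq_zero (f * β) ((1 - f) * β) (mul_mem hf hβ.mem_center)
    (mul_mem hf' hβ.mem_center) (hfi.mul_of_commute hcomm hβ.isIdempotentElem)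
    (hfi.one_sub.mul_of_commute hcomm' hβ.isIdempotentElem)
    (by rw [mul_assoc, ← mul_assoc β, hcomm'.symm.eq, ← mul_assoc, ← mul_assoc,
      hfi.mul_one_sub_self, zero_mul, zero_mul]) (by rw [← add_mul, add_sub_cancel, one_mul])
  rcases this with h0 | h0
  · exact absurd h0 h
  · rw [sub_mul, one_mul, sub_eq_zero] at h0
    exact h0.symm

theorem IsPrimitiveCentralIdempotent.eq_of_mul_ne_zero {γ : A}
    (hβ : IsPrimitiveCentralIdempotent β) (hγ : IsPrimitiveCentralIdempotent γ)
    (h : β * γ ≠ 0) : β = γ := by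
  have hcomm : β * γ = γ * β := (Subring.mem_center_iff.1 hβ.mem_center γ).symm
  rw [← hγ.mul_eq_self_of_mul_ne_zero hβ.mem_center hβ.isIdempotentElem h, hcomm,
    hβ.mul_eq_self_of_mul_ne_zero hγ.mem_center hγ.isIdempotentElem (hcomm ▸ h)]

end Primitive

/-! ### Splitting of the center over the base field -/

section Splitting

variable {K G : Type*} [Field K] [Group G] [Finite G] [NeZero (Nat.card G : K)]

theorem mapRingHom_mem_center {K G L : Type*} [Field K] [Group G] [Field L] (f : K →+* L)
    {z : K[G]} (hz : z ∈ Subring.center K[G]) :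
    MonoidAlgebra.mapRingHom G f z ∈ Subring.center L[G] := by
  refine Subring.mem_center_iff.2 fun b => ?_
  induction b using MonoidAlgebra.induction_linear with
  | zero => simp
  | add x y hx hy => rw [add_mul, mul_add, hx, hy]
  | single g r =>
    have h := congrArg (MonoidAlgebra.mapRingHom G f)
      (Subring.mem_center_iff.1 hz (MonoidAlgebra.single g 1))
    rw [map_mul, map_mul, MonoidAlgebra.mapRingHom_single, map_one] at h
    rw [← mul_one r, ← MonoidAlgebra.smul_single', smul_mul_assoc, mul_smul_comm, h]

/-- Over a field whose prime field contains the characters of `G`, every central element acts by a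
scalar on each primitive block of the group algebra. -/
theorem exists_mul_eq_smul_of_isPrimitive
    (hconj : ∀ (g : G) (n : ℕ), (orderOf g).Coprime n → IsConj g (g ^ n))
    (htot : ∀ g : G, ((orderOf g).totient : K) ≠ 0)
    {β : K[G]} (hβ : IsPrimitiveCentralIdempotent β) {z : K[G]} (hz : z ∈ Subring.center K[G]) :
    ∃ r : K, z * β = r • β := by
  classical
  let L := AlgebraicClosure K
  let φ : K[G] →+* L[G] := MonoidAlgebra.mapRingHom G (algebraMap K L)
  have hφcoeff (x : K[G]) (g : G) : (φ x).coeff g = algebraMap K L (x.coeff g) := by simp [φ]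
  have hφ : Function.Injective φ := fun x y h => by
    ext g
    apply (algebraMap K L).injective
    rw [← hφcoeff, ← hφcoeff, h]
  have : NeZero (Nat.card G : L) := ⟨by
    rw [← map_natCast (algebraMap K L)]
    exact (map_ne_zero _).2 (NeZero.ne _)⟩
  have htotL (g : G) : ((orderOf g).totient : L) ≠ 0 := by
    rw [← map_natCast (algebraMap K L)]
    exact (map_ne_zero _).2 (htot g)
  let Z := Subalgebra.center L L[G]
  have : IsArtinianRing Z := IsArtinianRing.of_finite L Z
  cases nonempty_fintype (MaximalSpectrum Z)
  -- The image of `K` in `L` is a subfield, so it contains the coefficients of every central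
  -- idempotent.
  have hdescent (m : MaximalSpectrum Z) : ∃ f : K[G], φ f = (componentIdempotent Z m : L[G]) := by
    have hid := (isIdempotentElem_componentIdempotent m).map Z.val
    choose c hc using fun g => coeff_mem_of_central_idempotent hconj htotL
      (algebraMap K L).fieldRange (componentIdempotent Z m).2 hid g
    refine ⟨.ofCoeff (Finsupp.equivFunOnFinite.symm c), ?_⟩
    ext g
    rw [hφcoeff]
    exact hc g
  choose f hf using hdescent
  have hfidem (m) : IsIdempotentElem (f m) := hφ <| by
    rw [map_mul, hf]
    exact (isIdempotentElem_componentIdempotent m).map Z.val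
  have hfcenter (m) : f m ∈ Subring.center K[G] := Subring.mem_center_iff.2 fun x => hφ <| by
    rw [map_mul, map_mul, hf]
    exact Subring.mem_center_iff.1 (componentIdempotent Z m).2 _
  have hfsum : ∑ m, f m = 1 := hφ <| by
    have h := congrArg Z.val (sum_componentIdempotent (Z := Z))
    rw [map_sum, map_one] at h ⊢
    simp_rw [hf]
    exact h
  obtain ⟨m, hm⟩ : ∃ m, f m * β ≠ 0 := by
    by_contra! h
    apply hβ.ne_zero
    rw [← one_mul β, ← hfsum, Finset.sum_mul, Finset.sum_eq_zero fun m _ => h m]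
  have hmβ : f m * β = β := hβ.mul_eq_self_of_mul_ne_zero (hfcenter m) (hfidem m) hm
  obtain ⟨r, hr⟩ := exists_mul_componentIdempotent_eq_smul (k := L)
    (⟨φ z, mapRingHom_mem_center _ hz⟩ : Z) m
  have hr' : φ z * φ (f m) = r • φ (f m) := by
    rw [hf]; exact congrArg Z.val hr
  have key : φ (z * β) = r • φ β := by
    rw [← hmβ, ← mul_assoc, map_mul, map_mul, hr', smul_mul_assoc, ← map_mul]
  obtain ⟨g, hg⟩ : ∃ g, β.coeff g ≠ 0 := by
    by_contra! h
    exact hβ.ne_zero (by ext g; simpa using h g)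
  have hcoeff (g : G) : algebraMap K L ((z * β).coeff g) = r * algebraMap K L (β.coeff g) := by
    rw [← hφcoeff, ← hφcoeff, key, MonoidAlgebra.coeff_smul_apply, smul_eq_mul]
  -- Comparing one nonzero coefficient of `β` shows that the scalar `r`, a priori in `L`, comes from
  -- `K`.
  have hrK : algebraMap K L ((z * β).coeff g / β.coeff g) = r := by
    rw [map_div₀, hcoeff, mul_div_cancel_right₀ _ ((map_ne_zero _).2 hg)]
  refine ⟨(z * β).coeff g / β.coeff g, ?_⟩
  ext h
  apply (algebraMap K L).injective
  rw [hcoeff, MonoidAlgebra.coeff_smul_apply, smul_eq_mul, map_mul, hrK]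

end Splitting

/-! ### Central idempotents acting on irreducible representations -/

section Representations

variable {K : Type*} [Field K] {G : Type*} [Group G] {V : Type*} [AddCommGroup V] [Module K V]
  {ρ : Representation K G V}

/-- A central idempotent acts on an irreducible representation as `0` or as `1`. -/
theorem asAlgebraHom_eq_zero_or_one (hρ : ρ.IsIrreducible) {f : K[G]}
    (hf : f ∈ Subring.center K[G]) (hfi : IsIdempotentElem f) :
    ρ.asAlgebraHom f = 0 ∨ ρ.asAlgebraHom f = 1 := by
  have : IsSimpleModule K[G] ρ.asModule :=
    (Representation.irreducible_iff_isSimpleModule_asModule ρ).1 hρ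
  -- Since `f` is central, it acts by a module endomorphism, to which Schur's lemma applies.
  let T : ρ.asModule →ₗ[K[G]] ρ.asModule :=
    { toFun := fun m => f • m
      map_add' := smul_add f
      map_smul' := fun a m => by
        rw [RingHom.id_apply, smul_smul, smul_smul, Subring.mem_center_iff.1 hf a] }
  rcases LinearMap.injective_or_eq_zero T with h | h
  · right
    ext v
    have : f • (f • (ρ.asModuleEquiv.symm v)) = f • (ρ.asModuleEquiv.symm v) := by
      rw [smul_smul, hfi.eq]
    exact h this
  · left
    ext v
    exact LinearMap.congr_fun h (ρ.asModuleEquiv.symm v)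

variable [Finite G] [NeZero (Nat.card G : K)]

theorem exists_primitive_family (K : Type*) [Field K] (G : Type*) [Group G] [Finite G]
    [NeZero (Nat.card G : K)] :
    ∃ s : Finset K[G], (∀ β ∈ s, IsPrimitiveCentralIdempotent β) ∧ ∑ β ∈ s, β = 1 := by
  classical
  let Z := Subalgebra.center K K[G]
  have : IsArtinianRing Z := IsArtinianRing.of_finite K Z
  cases nonempty_fintype (MaximalSpectrum Z)
  have hinj : Function.Injective fun m => (componentIdempotent Z m : K[G]) := by
    intro m m' h
    have h' : componentIdempotent Z m = componentIdempotent Z m' := Subtype.ext h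
    by_contra hne
    have h1 := congrFun (equivPi_mul_componentIdempotent (1 : Z) m) m
    have h2 := congrFun (equivPi_mul_componentIdempotent (1 : Z) m') m
    rw [← h', h1, Pi.single_eq_same, Pi.single_eq_of_ne hne, map_one] at h2
    exact one_ne_zero h2
  refine ⟨Finset.univ.image fun m => (componentIdempotent Z m : K[G]), ?_, ?_⟩
  · intro β hβ
    obtain ⟨m, -, rfl⟩ := Finset.mem_image.1 hβ
    refine ⟨(componentIdempotent Z m).2, (isIdempotentElem_componentIdempotent m).map Z.val,
      fun h => componentIdempotent_ne_zero m (Subtype.ext h), ?_⟩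
    intro e f he hf hei hfi hef hsum
    have hmul : e * (componentIdempotent Z m : K[G]) = e := by
      rw [hsum, mul_add, hei.eq, hef, add_zero]
    rcases mul_componentIdempotent_eq_zero_or_self (f := (⟨e, he⟩ : Z)) (Subtype.ext hei) m
      with h | h
    · left
      rw [← hmul]
      exact congrArg Z.val h
    · right
      have h' : e * (componentIdempotent Z m : K[G]) = componentIdempotent Z m :=
        congrArg Z.val h
      rw [hmul] at h'
      rw [← h'] at hsum
      exact left_eq_add.1 hsum
  · rw [Finset.sum_image fun m _ m' _ h => hinj h]
    have h := congrArg Z.val (sum_componentIdempotent (Z := Z))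
    rwa [map_sum, map_one] at h

theorem exists_primitive_asAlgebraHom_eq_one (hρ : ρ.IsIrreducible) :
    ∃ β : K[G], IsPrimitiveCentralIdempotent β ∧ ρ.asAlgebraHom β = 1 := by
  obtain ⟨s, hs, hsum⟩ := exists_primitive_family K G
  by_contra! h
  have hzero : ∀ β ∈ s, ρ.asAlgebraHom β = 0 := fun β hβ =>
    (asAlgebraHom_eq_zero_or_one hρ (hs β hβ).mem_center (hs β hβ).isIdempotentElem).resolve_right
      (h β (hs β hβ))
  have h1 := congrArg ρ.asAlgebraHom hsum
  rw [map_sum, Finset.sum_eq_zero hzero, map_one] at h1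
  have : IsSimpleModule K[G] ρ.asModule :=
    (Representation.irreducible_iff_isSimpleModule_asModule ρ).1 hρ
  have : Nontrivial V := IsSimpleModule.nontrivial K[G] ρ.asModule
  exact zero_ne_one h1

/-- An irreducible representation is faithful on the block acting on it as the identity. -/
theorem eq_zero_of_asAlgebraHom_eq_zero [Nontrivial V] {β : K[G]}
    (hβ : IsPrimitiveCentralIdempotent β)
    (h1 : ρ.asAlgebraHom β = 1) {x : K[G]} (hx : β * x = x) (h0 : ρ.asAlgebraHom x = 0) :
    x = 0 := by
  -- The kernel is generated by a central idempotent `e`. If `e * β ≠ 0`, primitivity would put `β`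
  -- in the kernel.
  obtain ⟨e, hec, hei, he0, hker⟩ := exists_central_idempotent_of_ker ρ.asAlgebraHom.toRingHom
  have he0' : ρ.asAlgebraHom e = 0 := he0
  have heβ : e * β = 0 := by
    by_contra h
    have := congrArg ρ.asAlgebraHom (hβ.mul_eq_self_of_mul_ne_zero hec hei h)
    rw [map_mul, he0', zero_mul, h1] at this
    exact zero_ne_one this
  rw [← hker x h0, ← hx, ← mul_assoc, heβ, zero_mul]

end Representations

/-! ### Bijection between irreducible classes and primitive idempotents -/

section Irreducible

variable {K : Type u} [Field K] {G : Type v} [Group G]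

theorem IrrRep.isSimpleModule (U : IrrRep K G) : IsSimpleModule K[G] U.1.ρ.asModule :=
  (Representation.irreducible_iff_isSimpleModule_asModule U.1.ρ).1 U.2

theorem IrrRep.nontrivial (U : IrrRep K G) : Nontrivial U.1.V :=
  have := U.isSimpleModule
  IsSimpleModule.nontrivial K[G] U.1.ρ.asModule

theorem asAlgebraHom_eq_one_of_equiv {U W : IrrRep K G}
    (h : Nonempty (Representation.Equiv U.1.ρ W.1.ρ)) {β : K[G]}
    (hβ : U.1.ρ.asAlgebraHom β = 1) : W.1.ρ.asAlgebraHom β = 1 := by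
  obtain ⟨e⟩ := h
  have key (x : K[G]) (v : U.1.V) :
      e (U.1.ρ.asAlgebraHom x v) = W.1.ρ.asAlgebraHom x (e v) := by
    induction x using MonoidAlgebra.induction_linear with
    | zero => simp
    | add x y hx hy => simp [hx, hy]
    | single g r =>
      simp only [Representation.asAlgebraHom_single, LinearMap.smul_apply, map_smul]
      congr 1
      exact LinearMap.congr_fun (e.toIntertwiningMap.isIntertwining' g) v
  ext w
  obtain ⟨v, rfl⟩ := e.toLinearEquiv.surjective w
  have := key β v
  rw [hβ] at this
  exact this.symm

variable [Finite G] [NeZero (Nat.card G : K)]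

/-- If `β` acted as `0`, then `β * 1` and `β * 0` would have the same image, against injectivity.
Conversely, the representation is faithful on the block of `β`. -/
theorem correspondsTo_iff {U : IrrRep K G} {β : K[G]} :
    CorrespondsTo U β ↔ IsPrimitiveCentralIdempotent β ∧ U.1.ρ.asAlgebraHom β = 1 := by
  have := U.nontrivial
  refine and_congr_right fun hβ => ⟨fun h => ?_, fun h => ⟨?_, ?_, ?_⟩⟩
  · refine (asAlgebraHom_eq_zero_or_one U.2 hβ.mem_center hβ.isIdempotentElem).resolve_left
      fun h0 => hβ.ne_zero (h.injOn ⟨1, mul_one β⟩ ⟨0, mul_zero β⟩ ?_)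
    rw [h0, map_zero]
  · exact fun x _ => ⟨x, rfl⟩
  · rintro _ ⟨x, rfl⟩ _ ⟨y, rfl⟩ hxy
    refine sub_eq_zero.1 (eq_zero_of_asAlgebraHom_eq_zero hβ h ?_ ?_)
    · rw [← mul_sub, ← mul_assoc, hβ.isIdempotentElem.eq]
    · rw [map_sub, hxy, sub_self]
  · rintro _ ⟨x, rfl⟩
    exact ⟨β * x, ⟨x, rfl⟩, by rw [map_mul, h, one_mul]⟩

theorem isIdempotentOf_mk_iff {U : IrrRep K G} {β : K[G]} :
    IsIdempotentOf (Quotient.mk (irrRepSetoid K G) U) β ↔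
      IsPrimitiveCentralIdempotent β ∧ U.1.ρ.asAlgebraHom β = 1 := by
  refine ⟨fun h => correspondsTo_iff.1 (h U rfl), fun h W hW => correspondsTo_iff.2 ⟨h.1, ?_⟩⟩
  exact asAlgebraHom_eq_one_of_equiv (Quotient.exact hW.symm) h.2

theorem existsUnique_isIdempotentOf (V : Irr K G) : ∃! β, IsIdempotentOf V β := by
  obtain ⟨U, rfl⟩ := Quotient.exists_rep V
  have := U.nontrivial
  obtain ⟨β, hβ, h1⟩ := exists_primitive_asAlgebraHom_eq_one U.2
  refine ⟨β, isIdempotentOf_mk_iff.2 ⟨hβ, h1⟩, fun γ hγ => ?_⟩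
  obtain ⟨hγ, h1'⟩ := isIdempotentOf_mk_iff.1 hγ
  refine hγ.eq_of_mul_ne_zero hβ fun h0 => ?_
  have := congrArg U.1.ρ.asAlgebraHom h0
  rw [map_mul, h1, h1', mul_one, map_zero] at this
  exact one_ne_zero this

theorem isIdempotentOf_idempotentOf (V : Irr K G) : IsIdempotentOf V (idempotentOf V) :=
  Classical.epsilon_spec (existsUnique_isIdempotentOf V).exists

theorem isPrimitive_idempotentOf (V : Irr K G) : IsPrimitiveCentralIdempotent (idempotentOf V) := by
  obtain ⟨U, rfl⟩ := Quotient.exists_rep V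
  exact (isIdempotentOf_mk_iff.1 (isIdempotentOf_idempotentOf _)).1

theorem exists_simple_submodule_of_isPrimitive {β : K[G]} (hβ : IsPrimitiveCentralIdempotent β) :
    ∃ S : Submodule K[G] K[G], IsSimpleModule K[G] S ∧ ∀ x ∈ S, β * x = x := by
  obtain ⟨S, hS, hle⟩ := (IsAtomic.eq_bot_or_exists_atom_le (Ideal.span {β})).resolve_left
    fun h => hβ.ne_zero (Ideal.span_singleton_eq_bot.1 h)
  refine ⟨S, isSimpleModule_iff_isAtom.2 hS, fun x hx => ?_⟩
  obtain ⟨a, rfl⟩ := Ideal.mem_span_singleton'.1 (hle hx)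
  rw [Subring.mem_center_iff.1 hβ.mem_center a, ← mul_assoc, hβ.isIdempotentElem.eq]

/-- A nonzero `s ∈ S` acts nontrivially on some `v`, by faithfulness on the block; so `x ↦ x v` is a
nonzero map of simple modules. This makes the class of `U` depend only on `β`. -/
theorem nonempty_linearEquiv_asModule {β : K[G]} (hβ : IsPrimitiveCentralIdempotent β)
    {S : Submodule K[G] K[G]} [IsSimpleModule K[G] S] (hS : ∀ x ∈ S, β * x = x) {U : IrrRep K G}
    (hU : U.1.ρ.asAlgebraHom β = 1) : Nonempty (S ≃ₗ[K[G]] U.1.ρ.asModule) := by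
  have := U.nontrivial
  have := U.isSimpleModule
  have := IsSimpleModule.nontrivial K[G] S
  obtain ⟨s, hs⟩ := exists_ne (0 : S)
  have hs0 : U.1.ρ.asAlgebraHom s.1 ≠ 0 := fun h =>
    hs (Subtype.ext (eq_zero_of_asAlgebraHom_eq_zero hβ hU (hS s s.2) h))
  obtain ⟨v, hv⟩ : ∃ v, U.1.ρ.asAlgebraHom s.1 v ≠ 0 := by
    by_contra! h
    exact hs0 (LinearMap.ext h)
  let f : S →ₗ[K[G]] U.1.ρ.asModule :=
    (LinearMap.toSpanSingleton K[G] U.1.ρ.asModule (U.1.ρ.asModuleEquiv.symm v)).comp S.subtype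
  refine ⟨LinearEquiv.ofBijective f (f.bijective_or_eq_zero.resolve_right fun h => hv ?_)⟩
  exact LinearMap.congr_fun h s

theorem idempotentOf_injective : Function.Injective (idempotentOf : Irr K G → K[G]) := by
  intro V W h
  obtain ⟨U, rfl⟩ := Quotient.exists_rep V
  obtain ⟨U', rfl⟩ := Quotient.exists_rep W
  obtain ⟨hβ, h1⟩ := isIdempotentOf_mk_iff.1 (isIdempotentOf_idempotentOf ⟦U⟧)
  obtain ⟨-, h1'⟩ := isIdempotentOf_mk_iff.1 (isIdempotentOf_idempotentOf ⟦U'⟧)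
  rw [← h] at h1'
  obtain ⟨S, hS, hSβ⟩ := exists_simple_submodule_of_isPrimitive hβ
  obtain ⟨e⟩ := nonempty_linearEquiv_asModule hβ hSβ h1
  obtain ⟨e'⟩ := nonempty_linearEquiv_asModule hβ hSβ h1'
  let f := (Representation.IntertwiningMap.equivLinearMapAsModule U.1.ρ U'.1.ρ).symm
    (e.symm.trans e').toLinearMap
  exact Quotient.sound ⟨f.ofBijective (e.symm.trans e').bijective⟩

theorem exists_idempotentOf_eq {β : K[G]} (hβ : IsPrimitiveCentralIdempotent β) :
    ∃ V : Irr K G, idempotentOf V = β := by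
  obtain ⟨S, hS, hSβ⟩ := exists_simple_submodule_of_isPrimitive hβ
  let _ : @Module K (RestrictScalars K K[G] S) _ AddCommGroup.toAddCommMonoid :=
    RestrictScalars.module K K[G] S
  let ρ : Representation K G (RestrictScalars K K[G] S) := Representation.ofModule S
  have hone : ρ.asAlgebraHom β = 1 := LinearMap.ext fun m => by
    refine (Representation.ofModule_asAlgebraHom_apply_apply (k := K) (G := G) S β m).trans ?_
    apply (RestrictScalars.addEquiv K K[G] S).injective
    rw [AddEquiv.apply_symm_apply]
    exact Subtype.ext (hSβ _ (RestrictScalars.addEquiv K K[G] S m).2)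
  have hirr : ρ.IsIrreducible :=
    (Representation.isSimpleModule_iff_irreducible_ofModule S).1 hS
  exact ⟨Quotient.mk _ ⟨Rep.of ρ, hirr⟩, (existsUnique_isIdempotentOf _).unique
    (isIdempotentOf_idempotentOf _) (isIdempotentOf_mk_iff.2 ⟨hβ, hone⟩)⟩

end Irreducible

/-! ### Class sums and the points of the zero locus -/

section Points

variable {K : Type u} [Field K] {G : Type v} [Group G] [Fintype G]

theorem classSum_one : classSum K (ConjClasses.mk (1 : G)) = 1 := by
  have : classElems (ConjClasses.mk (1 : G)) = {1} := by
    ext g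
    rw [mem_classElems, ConjClasses.mk_eq_mk_iff_isConj, Finset.mem_singleton, isConj_comm,
      isConj_one_right]
  rw [classSum, this, Finset.sum_singleton, MonoidAlgebra.one_def]

theorem coeff_classSum [DecidableEq (ConjClasses G)] (c : ConjClasses G) (g : G) :
    (classSum K c).coeff g = if ConjClasses.mk g = c then 1 else 0 := by
  classical
  rw [classSum, MonoidAlgebra.coeff_sum, Finset.sum_apply']
  simp [Finsupp.single_apply, mem_classElems]

theorem eq_sum_classSum [Fintype (ConjClasses G)] {z : K[G]} (hz : z ∈ Subring.center K[G]) :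
    z = ∑ c : ConjClasses G, z.coeff c.out • classSum K c := by
  classical
  ext g
  rw [MonoidAlgebra.coeff_sum, Finset.sum_apply']
  simp only [MonoidAlgebra.coeff_smul_apply, coeff_classSum, smul_eq_mul, mul_ite, mul_one,
    mul_zero, Finset.sum_ite_eq, Finset.mem_univ, if_true]
  refine coeff_conj_of_mem_center hz ?_
  rw [← ConjClasses.mk_eq_mk_iff_isConj]
  exact (Quotient.out_eq (ConjClasses.mk g)).symm

theorem centerPresentation_X (c : NonidClass G) :
    (centerPresentation K G (MvPolynomial.X c) : K[G]) = classSum K c.1 := by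
  simp [centerPresentation]

/-- Class sums span the center, and the one without a variable, that of the identity, is `1`. -/
theorem centerPresentation_surjective : Function.Surjective (centerPresentation K G) := by
  classical
  cases nonempty_fintype (ConjClasses G)
  intro z
  have hgen (c : ConjClasses G) :
      (⟨classSum K c, classSum_mem_center c⟩ : Subalgebra.center K K[G]) ∈
        (centerPresentation K G).range := by
    by_cases hc : c = ConjClasses.mk 1
    · subst hc
      convert one_mem (centerPresentation K G).range
      exact classSum_one
    · exact ⟨MvPolynomial.X ⟨c, hc⟩, Subtype.ext (centerPresentation_X _)⟩
  have hz : z = ∑ c : ConjClasses G, z.1.coeff c.out •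
      (⟨classSum K c, classSum_mem_center c⟩ : Subalgebra.center K K[G]) := by
    apply Subtype.ext
    rw [AddSubmonoidClass.coe_finsetSum]
    exact eq_sum_classSum z.2
  rw [← AlgHom.mem_range, hz]
  exact sum_mem fun c _ => Subalgebra.smul_mem _ (hgen c) _

/-- If the class sums act on `m` by the coordinates of `a`, then polynomials in them act by their
values at `a`. -/
theorem centerPresentation_apply_of_eigenvector {M : Type*} [AddCommGroup M] [Module K M]
    (T : K[G] →ₐ[K] Module.End K M) {a : NonidClass G → K} {m : M}
    (h : ∀ c : NonidClass G, T (classSum K c.1) m = a c • m) (f : MvPolynomial (NonidClass G) K) :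
    T (centerPresentation K G f : K[G]) m = MvPolynomial.eval a f • m := by
  induction f using MvPolynomial.induction_on with
  | C r =>
    have : (centerPresentation K G (MvPolynomial.C r) : K[G]) = algebraMap K K[G] r := by
      rw [centerPresentation, MvPolynomial.aeval_C]; rfl
    rw [this, AlgHom.commutes, MvPolynomial.eval_C, Module.algebraMap_end_apply]
  | add p q hp hq =>
    rw [map_add, map_add, add_smul, ← hp, ← hq, Subalgebra.coe_add, map_add, LinearMap.add_apply]
  | mul_X p c hp =>
    rw [map_mul, map_mul, Subalgebra.coe_mul, map_mul, Module.End.mul_apply, centerPresentation_X,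
      h, map_smul, hp, MvPolynomial.eval_X, smul_smul, mul_comm]

variable [NeZero (Nat.card G : K)]
  (hsplit : ∀ β : K[G], IsPrimitiveCentralIdempotent β → ∀ z ∈ Subring.center K[G],
    ∃ r : K, z * β = r • β)
include hsplit

/-- The central character of `V` on class sums is the unique point of `V(I)` attached to `V`. -/
theorem exists_isPointOf (V : Irr K G) :
    ∃ a, IsPointOf V a ∧ (∀ c : NonidClass G,
      classSum K c.1 * idempotentOf V = a c • idempotentOf V) ∧ ∀ b, IsPointOf V b → b = a := by
  have hβ := isPrimitive_idempotentOf V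
  choose a ha using fun c : NonidClass G =>
    hsplit _ hβ (classSum K c.1) (classSum_mem_center c.1)
  have heval (f : MvPolynomial (NonidClass G) K) :
      (centerPresentation K G f : K[G]) * idempotentOf V = MvPolynomial.eval a f • idempotentOf V :=
    centerPresentation_apply_of_eigenvector (Algebra.lmul K K[G]) ha f
  refine ⟨a, ⟨?_, ?_⟩, ha, ?_⟩
  · rw [points, MvPolynomial.mem_zeroLocus_iff]
    intro f hf
    have := heval f
    rw [RingHom.mem_ker.1 hf, ZeroMemClass.coe_zero, zero_mul, eq_comm, smul_eq_zero] at this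
    simpa [MvPolynomial.aeval_eq_eval] using this.resolve_right hβ.ne_zero
  · obtain ⟨f, hf⟩ := centerPresentation_surjective
      (⟨idempotentOf V, hβ.mem_center⟩ : Subalgebra.center K K[G])
    have hf' : (centerPresentation K G f : K[G]) = idempotentOf V := congrArg Subtype.val hf
    refine ⟨f, hf', fun h0 => hβ.ne_zero ?_⟩
    have := heval f
    rwa [h0, zero_smul, hf', hβ.isIdempotentElem.eq] at this
  · rintro b ⟨hb, f, hf, hfb⟩
    funext c
    -- This polynomial represents `(α_c - a_c) β_V = 0`; at a point where `f` is nonzero, the first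
    -- factor must vanish.
    have hker : (MvPolynomial.X c - MvPolynomial.C (a c)) * f ∈
        RingHom.ker (centerPresentation K G) := by
      rw [RingHom.mem_ker]
      apply Subtype.ext
      have hC : (centerPresentation K G (MvPolynomial.C (a c)) : K[G]) =
          algebraMap K K[G] (a c) := by
        rw [centerPresentation, MvPolynomial.aeval_C]; rfl
      rw [map_mul, map_sub, Subalgebra.coe_mul, Subalgebra.coe_sub, hf, centerPresentation_X, hC,
        sub_mul, ha, Algebra.smul_def, sub_self, ZeroMemClass.coe_zero]
    rw [points, MvPolynomial.mem_zeroLocus_iff] at hb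
    have := hb _ hker
    simp only [MvPolynomial.aeval_eq_eval, map_mul, map_sub] at this
    simpa [sub_eq_zero, hfb] using this

theorem existsUnique_isPointOf (V : Irr K G) : ∃! a, IsPointOf V a := by
  obtain ⟨a, h, -, hu⟩ := exists_isPointOf hsplit V
  exact ⟨a, h, hu⟩

theorem isPointOf_pointOf (V : Irr K G) : IsPointOf V (pointOf V) :=
  Classical.epsilon_spec (existsUnique_isPointOf hsplit V).exists

theorem classSum_mul_idempotentOf (V : Irr K G) (c : NonidClass G) :
    classSum K c.1 * idempotentOf V = pointOf V c • idempotentOf V := by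
  obtain ⟨a, -, ha, hu⟩ := exists_isPointOf hsplit V
  rw [hu _ (isPointOf_pointOf hsplit V)]
  exact ha c

end Points

/-! ### Decomposition of modules and its equations -/

section Decomposition

variable {K : Type u} [Field K] {G : Type v} [Group G]
  {M : Type*} [AddCommGroup M] [Module K M] (T : K[G] →ₐ[K] Module.End K M)

theorem mem_range_idempotentOf_iff [Finite G] [NeZero (Nat.card G : K)] (V : Irr K G) (m : M) :
    m ∈ LinearMap.range (T (idempotentOf V)) ↔ T (idempotentOf V) m = m := by
  refine ⟨?_, fun h => ⟨m, h⟩⟩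
  rintro ⟨n, rfl⟩
  rw [← Module.End.mul_apply, ← map_mul, (isPrimitive_idempotentOf V).isIdempotentElem.eq]

theorem isInternal_range_idempotentOf [Finite G] [NeZero (Nat.card G : K)] :
    DirectSum.IsInternal fun V : Irr K G => LinearMap.range (T (idempotentOf V)) := by
  refine (DirectSum.isInternal_submodule_iff_iSupIndep_and_iSup_eq_top _).2 ⟨?_, ?_⟩
  · intro V
    rw [Submodule.disjoint_def]
    intro m hm hm'
    have hle : (⨆ (W : Irr K G) (_ : W ≠ V), LinearMap.range (T (idempotentOf W))) ≤
        LinearMap.ker (T (idempotentOf V)) := by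
      refine iSup₂_le fun W hW => ?_
      rintro _ ⟨n, rfl⟩
      have : idempotentOf V * idempotentOf W = 0 := by
        by_contra h
        exact hW (idempotentOf_injective ((isPrimitive_idempotentOf V).eq_of_mul_ne_zero
          (isPrimitive_idempotentOf W) h)).symm
      rw [LinearMap.mem_ker, ← Module.End.mul_apply, ← map_mul, this, map_zero,
        LinearMap.zero_apply]
    rw [← (mem_range_idempotentOf_iff T V m).1 hm]
    exact hle hm'
  · rw [eq_top_iff]
    intro m _
    obtain ⟨s, hs, hsum⟩ := exists_primitive_family K G
    have hm : m = ∑ β ∈ s, T β m := by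
      rw [← LinearMap.sum_apply, ← map_sum, hsum, map_one, Module.End.one_apply]
    rw [hm]
    refine sum_mem fun β hβ => ?_
    obtain ⟨V, hV⟩ := exists_idempotentOf_eq (hs β hβ)
    exact Submodule.mem_iSup_of_mem V ⟨m, by rw [hV]⟩

theorem mem_range_idempotentOf_iff_classSum [Fintype G] [NeZero (Nat.card G : K)]
    (hsplit : ∀ β : K[G], IsPrimitiveCentralIdempotent β → ∀ z ∈ Subring.center K[G],
      ∃ r : K, z * β = r • β) (V : Irr K G) (m : M) :
    m ∈ LinearMap.range (T (idempotentOf V)) ↔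
      ∀ c : NonidClass G, T (classSum K c.1) m = pointOf V c • m := by
  constructor
  · rintro ⟨n, rfl⟩ c
    rw [← Module.End.mul_apply, ← map_mul, classSum_mul_idempotentOf hsplit, map_smul,
      LinearMap.smul_apply]
  · intro h
    -- `β_V` acts on `m` by the scalar `f(a_V) ≠ 0`, so dividing by it exhibits a preimage of `m`.
    obtain ⟨-, f, hf, hf0⟩ := isPointOf_pointOf hsplit V
    have key := centerPresentation_apply_of_eigenvector T h f
    rw [hf] at key
    refine ⟨(MvPolynomial.eval (pointOf V) f)⁻¹ • m, ?_⟩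
    rw [map_smul, key, inv_smul_smul₀ hf0]

end Decomposition

theorem asAlgebraHom_classSum_apply {K : Type*} [Field K] {X : Type*} {d : ℕ}
    (C : Subrepresentation (permuteVars d X K)) (c : ConjClasses (Equiv.Perm (Fin d)))
    (F : C.toSubmodule) (x : Fin d → X) :
    (C.toRepresentation.asAlgebraHom (classSum K c) F).1 x =
      ∑ σ ∈ classElems c, F.1 (fun i => x (σ i)) := by
  simp only [classSum, map_sum, Representation.asAlgebraHom_single_one, LinearMap.sum_apply,
    AddSubmonoidClass.coe_finsetSum, Finset.sum_apply]
  rfl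

end SymmetryClasses

open SymmetryClasses in
theorem theorem4p8 {K : Type*} [Field K] {X : Type*} (d : ℕ) (hd : 0 < d)
    (hK : ringChar K = 0 ∨ d < ringChar K)
    (C : Subrepresentation (permuteVars d X K)) :
    -- the idempotents `β_V` and the points `a_V` are well defined
    (∀ V : Irr K (Equiv.Perm (Fin d)),
      (∃! β, IsIdempotentOf V β) ∧ (∃! a, IsPointOf V a)) ∧
    -- `C = ⊕_V W_V`
    DirectSum.IsInternal (fun V : Irr K (Equiv.Perm (Fin d)) => symmetryClass C V) ∧
    -- the two descriptions of `W_V` by equations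
    ∀ (V : Irr K (Equiv.Perm (Fin d))) (F : C.toSubmodule),
      (F ∈ symmetryClass C V ↔
        ∀ (c : NonidClass (Equiv.Perm (Fin d))) (x : Fin d → X),
          ∑ σ ∈ classElems c.1, F.1 (fun i => x (σ i)) = pointOf V c * F.1 x) ∧
      (F ∈ symmetryClass C V ↔
        C.toRepresentation.asAlgebraHom (idempotentOf V) F = F) := by
  have : NeZero (Nat.card (Equiv.Perm (Fin d)) : K) := ⟨natCast_card_perm_ne_zero hK⟩
  have hsplit : ∀ β : K[Equiv.Perm (Fin d)], IsPrimitiveCentralIdempotent β →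
      ∀ z ∈ Subring.center K[Equiv.Perm (Fin d)], ∃ r : K, z * β = r • β := fun β hβ z hz =>
    exists_mul_eq_smul_of_isPrimitive isConj_pow_of_coprime
      (natCast_totient_orderOf_ne_zero hK) hβ hz
  refine ⟨fun V => ⟨existsUnique_isIdempotentOf V, existsUnique_isPointOf hsplit V⟩,
    isInternal_range_idempotentOf C.toRepresentation.asAlgebraHom, fun V F => ⟨?_, ?_⟩⟩
  · refine (mem_range_idempotentOf_iff_classSum C.toRepresentation.asAlgebraHom hsplit V F).trans
      (forall_congr' fun c => ?_)
    rw [Subtype.ext_iff, funext_iff]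
    refine forall_congr' fun x => ?_
    rw [asAlgebraHom_classSum_apply]
    rfl
  · exact mem_range_idempotentOf_iff C.toRepresentation.asAlgebraHom V F
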